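/- Let $X$ be a complex Banach space and let $T : X \to X$ be a bounded linear operator. For $A \subseteq \mathbb{N}$ let $$\overline{Bd}(A) := \lim_{n\to\infty} \sup_{k} \frac{\#\,(A \cap [k, k+n])}{n}$$ be its upper Banach density (the limit always exists). Suppose that $T$ has the $\mathscr{P}_{\overline{\mathcal{BD}}}$ property: for every nonempty open set $U \subseteq X$ there is $x \in X$ such that the set of return times $N(x,U) = \{n \in \mathbb{N} : T^n x \in U\}$ has positive upper Banach density. Let $\lambda \in \mathbb{C}$ with $|\lambda| = 1$. Then either $T = \lambda\, \mathrm{Id}$, or $T - \lambda\, \mathrm{Id}$ is not quasinilpotent, i.e. its spectral radius is not $0$. -/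

import Mathlib

open Filter Topology

noncomputable section

/-- The largest proportion `sup_k #(A ∩ [k, k + n]) / n` that `A` attains on a window
`[k, k + n]`. The supremum is over a set bounded by `2`. -/
def windowDensity (A : Set ℕ) (n : ℕ) : ℝ :=
  ⨆ k : ℕ, ((A ∩ Set.Icc k (k + n)).ncard : ℝ) / n

/-- The upper Banach density `lim_n sup_k #(A ∩ [k, k + n]) / n` of a set of natural numbers.
The limit exists for every `A` (`tendsto_windowDensity` below), so it is the upper limit. -/
def upperBanachDensity (A : Set ℕ) : ℝ :=
  limsup (fun n : ℕ => windowDensity A n) atTop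

theorem ncard_window_le (A : Set ℕ) (k n : ℕ) :
    (A ∩ Set.Ico k (k + n)).ncard ≤ n := by
  calc (A ∩ Set.Ico k (k + n)).ncard ≤ (Set.Ico k (k + n)).ncard :=
        Set.ncard_le_ncard Set.inter_subset_right (Set.finite_Ico _ _)
    _ = n := by
        rw [← Finset.coe_Ico, Set.ncard_coe_finset]; simp

theorem bdd_window (A : Set ℕ) (n : ℕ) :
    BddAbove (Set.range fun k : ℕ => ((A ∩ Set.Ico k (k + n)).ncard : ℝ)) := by
  refine ⟨n, ?_⟩
  rintro _ ⟨k, rfl⟩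
  exact Nat.cast_le.2 (ncard_window_le A k n)

theorem subadditive_window (A : Set ℕ) :
    Subadditive fun n : ℕ => ⨆ k : ℕ, ((A ∩ Set.Ico k (k + n)).ncard : ℝ) := by
  intro m n
  refine ciSup_le fun k => ?_
  have h1 : (A ∩ Set.Ico k (k + (m + n))).ncard ≤
      (A ∩ Set.Ico k (k + m)).ncard + (A ∩ Set.Ico (k + m) (k + m + n)).ncard := by
    refine le_trans (Set.ncard_le_ncard ?_ ?_) (Set.ncard_union_le _ _)
    · rintro x ⟨hx, h⟩
      simp only [Set.mem_union, Set.mem_inter_iff, Set.mem_Ico] at h ⊢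
      by_cases hxm : x < k + m
      · exact Or.inl ⟨hx, h.1, hxm⟩
      · exact Or.inr ⟨hx, by omega, by omega⟩
    · exact ((Set.finite_Ico _ _).inter_of_right _).union ((Set.finite_Ico _ _).inter_of_right _)
  calc ((A ∩ Set.Ico k (k + (m + n))).ncard : ℝ)
      ≤ ((A ∩ Set.Ico k (k + m)).ncard : ℝ) + ((A ∩ Set.Ico (k + m) (k + m + n)).ncard : ℝ) := by
        exact_mod_cast h1
    _ ≤ _ := add_le_add (le_ciSup (bdd_window A m) k) (le_ciSup (bdd_window A n) (k + m))

/-- The limit that defines the upper Banach density exists. -/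
theorem tendsto_windowDensity (A : Set ℕ) :
    Tendsto (windowDensity A) atTop (𝓝 (upperBanachDensity A)) := by
  suffices h : ∃ l, Tendsto (windowDensity A) atTop (𝓝 l) by
    obtain ⟨l, hl⟩ := h
    have : upperBanachDensity A = l := hl.limsup_eq
    rwa [this]
  have hs := subadditive_window A
  have hb : BddBelow (Set.range fun n : ℕ =>
      (⨆ k : ℕ, ((A ∩ Set.Ico k (k + n)).ncard : ℝ)) / n) := by
    refine ⟨0, ?_⟩
    rintro _ ⟨n, rfl⟩
    exact div_nonneg (Real.iSup_nonneg fun k => Nat.cast_nonneg _) (Nat.cast_nonneg _)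
  have h1 := (tendsto_add_atTop_iff_nat 1).2 (hs.tendsto_lim hb)
  have h2 : Tendsto (fun n : ℕ => 1 + 1 / (n : ℝ)) atTop (𝓝 (1 + 0)) :=
    tendsto_const_nhds.add tendsto_one_div_atTop_nhds_zero_nat
  refine ⟨_, (h1.mul h2).congr' ?_⟩
  filter_upwards [eventually_gt_atTop 0] with n hn
  have hn' : (n : ℝ) ≠ 0 := by positivity
  have hw : windowDensity A n =
      (⨆ k : ℕ, ((A ∩ Set.Ico k (k + (n + 1))).ncard : ℝ)) / n := by
    rw [windowDensity, div_eq_mul_inv, Real.iSup_mul_of_nonneg (by positivity)]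
    refine iSup_congr fun k => ?_
    rw [div_eq_mul_inv]
    congr 4
    ext x
    simp only [Set.mem_Icc, Set.mem_Ico]
    omega
  rw [hw]
  have hn1 : (n : ℝ) + 1 ≠ 0 := by positivity
  push_cast
  field_simp

/-- The family of sets of natural numbers with positive upper Banach density. -/
def positiveUpperBanachDensity : Set (Set ℕ) :=
  {A | 0 < upperBanachDensity A}

/-- The set of return times `N_T(x, U) = {n : T ^ n x ∈ U}`. -/
def returnTimes {X : Type*} [NormedAddCommGroup X] [NormedSpace ℂ X]
    (T : X →L[ℂ] X) (x : X) (U : Set X) : Set ℕ :=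
  {n | (T ^ n) x ∈ U}

/-- `T` has the `P_F` property for a family `F` of sets of natural numbers: every nonempty open
set `U` admits a point `x` of the space whose set of return times `N_T(x, U)` belongs to `F`. -/
def HasPProperty {X : Type*} [NormedAddCommGroup X] [NormedSpace ℂ X]
    (F : Set (Set ℕ)) (T : X →L[ℂ] X) : Prop :=
  ∀ U : Set X, IsOpen U → U.Nonempty → ∃ x : X, returnTimes T x U ∈ F

/-- A bounded operator is quasinilpotent if its spectral radius is zero. -/
def IsQuasinilpotentOp {X : Type*} [NormedAddCommGroup X] [NormedSpace ℂ X]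
    (S : X →L[ℂ] X) : Prop :=
  spectralRadius ℂ S = 0

end

/-! Suppose `Q = T - z` is quasinilpotent and nonzero. Some `Q v` is not a multiple of `v`, as `Q`
has no nonzero eigenvalue, so a functional `f` exists with `f v = 1` and `f (T v) = -z`. Put `R =
z⁻¹ T`. Whenever the orbit of `x` visits a small neighbourhood of `v`, `z ^ i * f (R ^ i x)` is near
`1` and `z ^ i * f (R ^ (i + 1) x)` is near `-1`. Keeping a quarter of these times and rotating by a
fixed `u`, the real sequence `a i = Re (u f (R ^ i x))` drops from `≥ 1/4` to `≤ -1/4` at a positive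
proportion of places in arbitrarily long windows.

A sequence with `r` such drops in a window of length `L` has a divided difference of order `m = 2r -
1` of size at least `c / L ^ m` (`le_abs_dividedDiff_of_sign_changes`). It is also at most `1 / m!`
times the largest `m`-th forward difference (`abs_dividedDiff_le`), and those differences are
governed by `(R - 1) ^ m`. As `L ^ m / m! ≤ e ^ L`, `‖(R - 1) ^ m‖` is at least exponentially small
in `L`. But `m` is proportional to `L`, and quasinilpotence makes this norm smaller than any `η ^
m`. -/

/-! ### Divided differences on integer nodes. -/

/-- The divided difference of `a` over the finite set `s` of natural nodes. -/
noncomputable def dividedDiff (s : Finset ℕ) (a : ℕ → ℝ) : ℝ :=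
  ∑ i ∈ s, a i * ∏ j ∈ s.erase i, ((i : ℝ) - j)⁻¹

/-- The factor `i - v` cancels the node `v` and kills the term `i = v`, so difference quotients over
different node sets become sums over the same `t`. -/
theorem dividedDiff_erase {t : Finset ℕ} {v : ℕ} (hv : v ∈ t) (a : ℕ → ℝ) :
    dividedDiff (t.erase v) a =
      ∑ i ∈ t, a i * (((i : ℝ) - v) * ∏ j ∈ t.erase i, ((i : ℝ) - j)⁻¹) := by
  rw [dividedDiff, ← Finset.add_sum_erase t _ hv, sub_self, zero_mul, mul_zero, zero_add]
  refine Finset.sum_congr rfl fun i hi => ?_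
  have hne : i ≠ v := (Finset.mem_erase.1 hi).1
  have hne' : (i : ℝ) - v ≠ 0 := sub_ne_zero.2 (by exact_mod_cast hne)
  have hmem : v ∈ t.erase i := Finset.mem_erase.2 ⟨hne.symm, hv⟩
  rw [← Finset.mul_prod_erase (t.erase i) _ hmem, mul_inv_cancel_left₀ hne',
    Finset.erase_right_comm]

theorem sub_mul_dividedDiff {t : Finset ℕ} {u v : ℕ} (hu : u ∈ t) (hv : v ∈ t) (a : ℕ → ℝ) :
    ((u : ℝ) - v) * dividedDiff t a =
      dividedDiff (t.erase v) a - dividedDiff (t.erase u) a := by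
  rw [dividedDiff_erase hv, dividedDiff_erase hu, dividedDiff, Finset.mul_sum,
    ← Finset.sum_sub_distrib]
  exact Finset.sum_congr rfl fun i _ => by ring

/-- Over consecutive nodes the divided difference is an iterated forward difference. -/
theorem dividedDiff_Icc (a : ℕ → ℝ) (m p : ℕ) :
    dividedDiff (Finset.Icc p (p + m)) a = (fwdDiff 1)^[m] a p / m.factorial := by
  induction m generalizing p with
  | zero => simp [dividedDiff]
  | succ m ih =>
    have h := sub_mul_dividedDiff (t := Finset.Icc p (p + (m + 1))) (u := p + (m + 1)) (v := p)
      (by simp) (by simp) a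
    have h1 : (Finset.Icc p (p + (m + 1))).erase p = Finset.Icc (p + 1) (p + 1 + m) := by
      ext x; simp only [Finset.mem_erase, Finset.mem_Icc]; omega
    have h2 : (Finset.Icc p (p + (m + 1))).erase (p + (m + 1)) = Finset.Icc p (p + m) := by
      ext x; simp only [Finset.mem_erase, Finset.mem_Icc]; omega
    rw [h1, h2, ih, ih] at h
    rw [Function.iterate_succ_apply', fwdDiff, Nat.factorial_succ]
    have hm : ((m : ℝ) + 1) ≠ 0 := by positivity
    have hf : (m.factorial : ℝ) ≠ 0 := by positivity
    push_cast at h ⊢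
    field_simp
    field_simp at h
    linear_combination h

/-- A divided difference of order `m` is at most `B / m!` in absolute value if the forward
differences of order `m` are at most `B`. -/
theorem abs_dividedDiff_le (a : ℕ → ℝ) (m : ℕ) (B : ℝ) (l p : ℕ) (s : Finset ℕ)
    (hs : s ⊆ Finset.Icc p (p + l)) (hcard : s.card = m + 1)
    (hB : ∀ i, p ≤ i → i + m ≤ p + l → |(fwdDiff 1)^[m] a i| ≤ B) :
    |dividedDiff s a| ≤ B / m.factorial := by
  induction l generalizing p s with
  | zero =>
    have h1 := Finset.card_le_card hs
    have hm : m = 0 := by simp at h1; omega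
    subst hm
    have h2 : s = Finset.Icc p (p + 0) := Finset.eq_of_subset_of_card_le hs (by simp [hcard])
    rw [h2, dividedDiff_Icc, abs_div, Nat.abs_cast]
    gcongr
    exact hB p le_rfl (by omega)
  | succ l ih =>
    by_cases hp : p ∈ s
    swap
    · refine ih (p + 1) s (fun x hx => ?_) hcard fun i hi hi' => hB i (by omega) (by omega)
      have h1 := hs hx
      have h2 : x ≠ p := fun h => hp (h ▸ hx)
      simp only [Finset.mem_Icc] at h1 ⊢
      omega
    by_cases hq : p + (l + 1) ∈ s
    swap
    · refine ih p s (fun x hx => ?_) hcard fun i hi hi' => hB i (by omega) (by omega)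
      have h1 := hs hx
      have h2 : x ≠ p + (l + 1) := fun h => hq (h ▸ hx)
      simp only [Finset.mem_Icc] at h1 ⊢
      omega
    by_cases hfull : s = Finset.Icc p (p + (l + 1))
    · have hm : m = l + 1 := by
        rw [hfull, Nat.card_Icc] at hcard; omega
      rw [hfull, ← hm, dividedDiff_Icc, abs_div, Nat.abs_cast]
      gcongr
      exact hB p le_rfl (by omega)
    -- Both endpoints are nodes but some interior `q` is not. After inserting `q`, the divided
    -- difference over `s` is a convex combination of those that omit one endpoint instead, and
    -- these live in shorter windows.
    obtain ⟨q, hqI, hqs⟩ := Finset.exists_of_ssubset (hs.ssubset_of_ne hfull)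
    have hpq : q ≠ p := fun h => hqs (h ▸ hp)
    have hqu : q ≠ p + (l + 1) := fun h => hqs (h ▸ hq)
    have hqI' := Finset.mem_Icc.1 hqI
    set u := p + (l + 1) with hu
    set t := insert q s with ht
    have htq : t.erase q = s := Finset.erase_insert hqs
    have hct : t.card = m + 2 := by rw [ht, Finset.card_insert_of_notMem hqs, hcard]
    have hpt : p ∈ t := Finset.mem_insert_of_mem hp
    have hut : u ∈ t := Finset.mem_insert_of_mem hq
    have hqt : q ∈ t := Finset.mem_insert_self _ _
    have htI : t ⊆ Finset.Icc p u := Finset.insert_subset hqI hs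
    have e1 := sub_mul_dividedDiff hut hqt a
    have e2 := sub_mul_dividedDiff hqt hpt a
    rw [htq] at e1 e2
    have b1 : |dividedDiff (t.erase u) a| ≤ B / m.factorial := by
      refine ih p _ (fun x hx => ?_) ?_ fun i hi hi' => hB i (by omega) (by omega)
      · have h1 := htI (Finset.mem_of_mem_erase hx)
        have h2 := Finset.ne_of_mem_erase hx
        simp only [Finset.mem_Icc] at h1 ⊢
        omega
      · rw [Finset.card_erase_of_mem hut, hct]; rfl
    have b2 : |dividedDiff (t.erase p) a| ≤ B / m.factorial := by
      refine ih (p + 1) _ (fun x hx => ?_) ?_ fun i hi hi' => hB i (by omega) (by omega)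
      · have h1 := htI (Finset.mem_of_mem_erase hx)
        have h2 := Finset.ne_of_mem_erase hx
        simp only [Finset.mem_Icc] at h1 ⊢
        omega
      · rw [Finset.card_erase_of_mem hpt, hct]; rfl
    have k1 : (0 : ℝ) < q - p := sub_pos.2 (by exact_mod_cast (by omega : p < q))
    have k2 : (0 : ℝ) < u - q := sub_pos.2 (by exact_mod_cast (by omega : q < u))
    have e3 : ((u : ℝ) - p) * dividedDiff s a =
        (q - p) * dividedDiff (t.erase u) a + (u - q) * dividedDiff (t.erase p) a := by
      linear_combination ((u : ℝ) - q) * e2 - ((q : ℝ) - p) * e1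
    rw [abs_le] at b1 b2 ⊢
    have k3 : (0 : ℝ) < u - p := by linarith
    constructor
    · refine le_of_mul_le_mul_left ?_ k3
      rw [e3]
      linarith [mul_le_mul_of_nonneg_left b1.1 k1.le, mul_le_mul_of_nonneg_left b2.1 k2.le]
    · refine le_of_mul_le_mul_left ?_ k3
      rw [e3]
      linarith [mul_le_mul_of_nonneg_left b1.2 k1.le, mul_le_mul_of_nonneg_left b2.2 k2.le]

/-! ### Sign changes force large divided differences. -/

/-- A factor `1` at `i` keeps the index set equal to `s`, so that the product can be grouped into
pairs `j, j + 1`. -/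
theorem prod_erase_inv_sub_eq (s : Finset ℕ) (i : ℕ) :
    ∏ j ∈ s.erase i, ((i : ℝ) - j)⁻¹ = ∏ j ∈ s, if j = i then 1 else ((i : ℝ) - j)⁻¹ := by
  by_cases hi : i ∈ s
  · rw [← Finset.mul_prod_erase s _ hi, if_pos rfl, one_mul]
    exact Finset.prod_congr rfl fun j hj => by rw [if_neg (Finset.ne_of_mem_erase hj)]
  · rw [Finset.erase_eq_of_notMem hi]
    exact Finset.prod_congr rfl fun j hj => by rw [if_neg (fun h : j = i => hi (h ▸ hj))]

theorem inv_pow_le_abs_prod_erase (s : Finset ℕ) (k l i : ℕ) (hs : s ⊆ Finset.Icc k (k + l))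
    (hi : i ∈ s) :
    ((l : ℝ) ^ (s.card - 1))⁻¹ ≤ |∏ j ∈ s.erase i, ((i : ℝ) - j)⁻¹| := by
  rw [Finset.abs_prod, ← Finset.card_erase_of_mem hi, ← inv_pow, ← Finset.prod_const]
  refine Finset.prod_le_prod (fun _ _ => by positivity) fun j hj => ?_
  have hne := Finset.ne_of_mem_erase hj
  have h1 := Finset.mem_Icc.1 (hs hi)
  have h2 := Finset.mem_Icc.1 (hs (Finset.mem_of_mem_erase hj))
  rw [abs_inv]
  have h3 : (0 : ℝ) < |(i : ℝ) - j| := abs_pos.2 (sub_ne_zero.2 (by exact_mod_cast hne.symm))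
  refine inv_anti₀ h3 ?_
  have h4 : (i : ℝ) ≤ k + l := by exact_mod_cast h1.2
  have h5 : (j : ℝ) ≤ k + l := by exact_mod_cast h2.2
  have h6 : (k : ℝ) ≤ i := by exact_mod_cast h1.1
  have h7 : (k : ℝ) ≤ j := by exact_mod_cast h2.1
  rw [abs_le]
  constructor <;> linarith

/-- If `a` drops from at least `c` to at most `-c` between `i` and `i + 1` for every `i` in a
finite set `A`, then the divided difference of `a` over `A ∪ (A + 1)` is bounded below. -/
theorem le_abs_dividedDiff_of_sign_changes (a : ℕ → ℝ) (c : ℝ) (hc : 0 < c) (A : Finset ℕ)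
    (hA : A.Nonempty) (k l : ℕ) (hAk : A ⊆ Finset.Icc k (k + l))
    (h1 : ∀ i ∈ A, c ≤ a i) (h2 : ∀ i ∈ A, a (i + 1) ≤ -c) :
    ∃ s : Finset ℕ, s ⊆ Finset.Icc k (k + (l + 1)) ∧ s.card = 2 * A.card - 1 + 1 ∧
      c * (((l + 1 : ℕ) : ℝ) ^ (2 * A.card - 1))⁻¹ ≤ |dividedDiff s a| := by
  have hsep : ∀ i ∈ A, ∀ j ∈ A, i ≠ j + 1 := by
    rintro i hi j hj rfl
    linarith [h1 _ hi, h2 _ hj]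
  have hinj : Set.InjOn (fun x : ℕ => x + 1) A := fun x _ y _ h => by simpa using h
  have hdisj : Disjoint A (A.image (· + 1)) := by
    rw [Finset.disjoint_left]
    intro i hi hi'
    obtain ⟨j, hj, rfl⟩ := Finset.mem_image.1 hi'
    exact hsep _ hi j hj rfl
  set s := A ∪ A.image (· + 1) with hs
  have hcard : s.card = 2 * A.card := by
    rw [hs, Finset.card_union_of_disjoint hdisj, Finset.card_image_of_injOn hinj]; ring
  have hpos := hA.card_pos
  have hsub : s ⊆ Finset.Icc k (k + (l + 1)) := by
    intro x hx
    rcases Finset.mem_union.1 hx with hx | hx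
    · have := Finset.mem_Icc.1 (hAk hx)
      exact Finset.mem_Icc.2 ⟨by omega, by omega⟩
    · obtain ⟨j, hj, rfl⟩ := Finset.mem_image.1 hx
      have := Finset.mem_Icc.1 (hAk hj)
      exact Finset.mem_Icc.2 ⟨by omega, by omega⟩
  have hprod (h : ℕ → ℝ) : ∏ j ∈ s, h j = ∏ j ∈ A, h j * h (j + 1) := by
    rw [hs, Finset.prod_union hdisj, Finset.prod_image hinj, Finset.prod_mul_distrib]
  -- A pair `j, j + 1` not containing the node lies on one side of it and contributes a positive
  -- factor. The node's own pair contributes `-1` at `i ∈ A` and `1` at `i + 1`, opposite to the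
  -- sign of `a`, so all terms are negative and cannot cancel.
  have hterm : ∀ i ∈ s, a i * ∏ j ∈ s.erase i, ((i : ℝ) - j)⁻¹ ≤
      -(c * |∏ j ∈ s.erase i, ((i : ℝ) - j)⁻¹|) := by
    intro i hi
    rcases Finset.mem_union.1 hi with hi | hi
    · have hneg : ∏ j ∈ s.erase i, ((i : ℝ) - j)⁻¹ < 0 := by
        rw [prod_erase_inv_sub_eq, hprod, ← Finset.mul_prod_erase A _ hi]
        refine mul_neg_of_neg_of_pos (by simp) (Finset.prod_pos fun j hj => ?_)
        have hj' := Finset.mem_erase.1 hj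
        have hne := hsep i hi j hj'.2
        rw [if_neg hj'.1, if_neg hne.symm, ← mul_inv]
        refine inv_pos.2 ?_
        rcases Nat.lt_or_ge j i with hlt | hge
        · have : (j : ℝ) + 1 < i := by exact_mod_cast (by omega : j + 1 < i)
          push_cast
          exact mul_pos (by linarith) (by linarith)
        · have : (i : ℝ) < j := by exact_mod_cast (by omega : i < j)
          push_cast
          exact mul_pos_of_neg_of_neg (by linarith) (by linarith)
      rw [abs_of_neg hneg]
      nlinarith [h1 i hi]
    · obtain ⟨i, hi', rfl⟩ := Finset.mem_image.1 hi
      replace hi := hi'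
      have hpos : 0 < ∏ j ∈ s.erase (i + 1), (((i + 1 : ℕ) : ℝ) - j)⁻¹ := by
        rw [prod_erase_inv_sub_eq, hprod, ← Finset.mul_prod_erase A _ hi]
        refine mul_pos (by simp) (Finset.prod_pos fun j hj => ?_)
        have hj' := Finset.mem_erase.1 hj
        have hne := hsep j hj'.2 i hi
        rw [if_neg hne, if_neg (by omega), ← mul_inv]
        refine inv_pos.2 ?_
        rcases Nat.lt_or_ge j i with hlt | hge
        · have : (j : ℝ) < i := by exact_mod_cast hlt
          push_cast
          exact mul_pos (by linarith) (by linarith)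
        · have : (i : ℝ) + 1 < j := by exact_mod_cast (by omega : i + 1 < j)
          push_cast
          exact mul_pos_of_neg_of_neg (by linarith) (by linarith)
      rw [abs_of_pos hpos]
      nlinarith [h2 i hi]
  refine ⟨s, hsub, by omega, ?_⟩
  obtain ⟨i, hi⟩ := hA
  have his : i ∈ s := Finset.mem_union_left _ hi
  have hlow := inv_pow_le_abs_prod_erase s k (l + 1) i hsub his
  rw [hcard] at hlow
  have hsum : dividedDiff s a ≤ -(c * |∏ j ∈ s.erase i, ((i : ℝ) - j)⁻¹|) := by
    rw [dividedDiff, ← Finset.add_sum_erase s _ his]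
    have : ∑ x ∈ s.erase i, a x * ∏ j ∈ s.erase x, ((x : ℝ) - j)⁻¹ ≤ 0 :=
      Finset.sum_nonpos fun x hx => (hterm x (Finset.mem_of_mem_erase hx)).trans
        (neg_nonpos.2 (by positivity))
    linarith [hterm i his]
  have := mul_le_mul_of_nonneg_left hlow hc.le
  have := neg_le_abs (dividedDiff s a)
  linarith

/-- If `a` drops from at least `c` to at most `-c` at `r` places in a window, then its forward
differences of order `2 * r - 1` in that window cannot all be small. -/
theorem sign_changes_bound (a : ℕ → ℝ) (c B : ℝ) (hc : 0 < c) (A : Finset ℕ)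
    (hA : A.Nonempty) (k l : ℕ) (hAk : A ⊆ Finset.Icc k (k + l))
    (h1 : ∀ i ∈ A, c ≤ a i) (h2 : ∀ i ∈ A, a (i + 1) ≤ -c)
    (hB : ∀ i, k ≤ i → i ≤ k + (l + 1) → |(fwdDiff 1)^[2 * A.card - 1] a i| ≤ B) :
    c ≤ B * Real.exp (l + 1) := by
  obtain ⟨s, hs, hcard, hle⟩ := le_abs_dividedDiff_of_sign_changes a c hc A hA k l hAk h1 h2
  have hup := abs_dividedDiff_le a (2 * A.card - 1) B (l + 1) k s hs hcard
    fun i hi hi' => hB i hi (by omega)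
  set m := 2 * A.card - 1
  have hB0 : 0 ≤ B := (abs_nonneg _).trans (hB k le_rfl (by omega))
  have hl : (0 : ℝ) < ((l + 1 : ℕ) : ℝ) ^ m := by positivity
  have h3 := hle.trans hup
  rw [← div_eq_mul_inv, div_le_iff₀ hl] at h3
  -- Bounding `L ^ m / m!` by `e ^ L` removes the dependence on the order `m`.
  calc c ≤ B * (((l + 1 : ℕ) : ℝ) ^ m / m.factorial) := by
        rw [mul_div]; rwa [div_mul_eq_mul_div] at h3
    _ ≤ B * Real.exp ((l + 1 : ℕ) : ℝ) :=
        mul_le_mul_of_nonneg_left (Real.pow_div_factorial_le_exp _ (by positivity) m) hB0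
    _ = _ := by push_cast; rfl

/-! ### Dense windows and rotations into a half plane. -/

theorem exists_window_of_upperBanachDensity_pos {A : Set ℕ} (hA : 0 < upperBanachDensity A) :
    ∃ d : ℝ, 0 < d ∧ ∀ᶠ n : ℕ in atTop, ∃ k : ℕ,
      d * n < ((A ∩ Set.Icc k (k + n)).ncard : ℝ) := by
  refine ⟨upperBanachDensity A / 2, half_pos hA, ?_⟩
  filter_upwards [(tendsto_windowDensity A).eventually_const_lt (half_lt_self hA),
    eventually_gt_atTop 0] with n hn hn0
  obtain ⟨k, hk⟩ := exists_lt_of_lt_ciSup hn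
  exact ⟨k, (lt_div_iff₀ (by exact_mod_cast hn0)).1 hk⟩

/-- Every complex number of modulus one is moved into a half plane by a fourth root of unity. -/
theorem exists_half_le_re_mul (w : ℂ) (hw : ‖w‖ = 1) :
    ∃ u ∈ ({1, -1, Complex.I, -Complex.I} : Finset ℂ), 1 / 2 ≤ (u * w).re := by
  have h : w.re * w.re + w.im * w.im = 1 := by
    rw [← Complex.normSq_apply, Complex.normSq_eq_norm_sq, hw, one_pow]
  by_contra! hcon
  have h1 := hcon 1 (by simp)
  have h2 := hcon (-1) (by simp)
  have h3 := hcon Complex.I (by simp)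
  have h4 := hcon (-Complex.I) (by simp)
  simp at h1 h2 h3 h4
  nlinarith

theorem norm_eq_one_of_mem_fourth_roots {u : ℂ}
    (hu : u ∈ ({1, -1, Complex.I, -Complex.I} : Finset ℂ)) : ‖u‖ = 1 := by
  simp only [Finset.mem_insert, Finset.mem_singleton] at hu
  rcases hu with rfl | rfl | rfl | rfl <;> simp

theorem quarter_le_re_mul {w y : ℂ} (hw : ‖w‖ = 1) (hre : 1 / 2 ≤ w.re) (hy : ‖y - 1‖ < 1 / 4) :
    1 / 4 ≤ (w * y).re := by
  have h1 : w * y = w + w * (y - 1) := by ring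
  have h2 := Complex.abs_re_le_norm (w * (y - 1))
  rw [norm_mul, hw, one_mul] at h2
  rw [h1, Complex.add_re]
  linarith [(abs_le.1 h2).1]

/-! ### Quasinilpotent operators, functionals and differences along orbits. -/

section

variable {X : Type*} [NormedAddCommGroup X] [NormedSpace ℂ X]

/-- Gelfand's formula. -/
theorem IsQuasinilpotentOp.eventually_norm_pow_le [CompleteSpace X] {S : X →L[ℂ] X}
    (hS : IsQuasinilpotentOp S) {r : ℝ} (hr : 0 < r) : ∀ᶠ m : ℕ in atTop, ‖S ^ m‖ ≤ r ^ m := by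
  have h := spectrum.pow_norm_pow_one_div_tendsto_nhds_spectralRadius S
  rw [show spectralRadius ℂ S = 0 from hS] at h
  filter_upwards [h.eventually_lt_const (ENNReal.ofReal_pos.2 hr), eventually_gt_atTop 0]
    with m hm hm0
  have h1 := (ENNReal.ofReal_lt_ofReal_iff hr).1 hm
  calc ‖S ^ m‖ = (‖S ^ m‖ ^ (1 / m : ℝ)) ^ m := by
        rw [one_div, Real.rpow_inv_natCast_pow (norm_nonneg _) hm0.ne']
    _ ≤ r ^ m := pow_le_pow_left₀ (by positivity) h1.le m

/-- A quasinilpotent operator has no eigenvalue other than zero. -/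
theorem IsQuasinilpotentOp.eq_zero_of_apply_eq_smul [CompleteSpace X] {S : X →L[ℂ] X}
    (hS : IsQuasinilpotentOp S) {x : X} {c : ℂ} (h : S x = c • x) : c • x = 0 := by
  by_contra hne
  obtain ⟨hc, hx⟩ := smul_ne_zero_iff.1 hne
  have hc' : 0 < ‖c‖ := norm_pos_iff.2 hc
  have hx' : 0 < ‖x‖ := norm_pos_iff.2 hx
  have hpow : ∀ m : ℕ, (S ^ m) x = c ^ m • x := by
    intro m
    induction m with
    | zero => simp
    | succ m ih => rw [pow_succ, mul_apply_eq_comp, h, map_smul, ih, smul_smul,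
        ← pow_succ']
  obtain ⟨m, hm, hm0⟩ :=
    ((hS.eventually_norm_pow_le (half_pos hc')).and (eventually_gt_atTop 0)).exists
  have h1 := (S ^ m).le_opNorm x
  rw [hpow, norm_smul, norm_pow] at h1
  have h2 := (le_of_mul_le_mul_right h1 hx').trans hm
  exact absurd h2 (not_le.2 (pow_lt_pow_left₀ (half_lt_self hc') (by positivity) hm0.ne'))

/-- By Hahn–Banach take `g v = 1` and `h (w - g w • v) = 1`. Then `h - h v • g` vanishes at `v` and
equals `1` at `w`, so a multiple of it corrects `g`. -/
theorem exists_dual_apply_eq {v w : X} (hv : v ≠ 0) (hw : ∀ c : ℂ, w ≠ c • v) (b : ℂ) :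
    ∃ f : X →L[ℂ] ℂ, f v = 1 ∧ f w = b := by
  obtain ⟨g, hg⟩ := SeparatingDual.exists_eq_one (R := ℂ) hv
  obtain ⟨h, hh⟩ := SeparatingDual.exists_eq_one (R := ℂ) (sub_ne_zero.2 (hw (g w)))
  rw [map_sub, map_smul, smul_eq_mul] at hh
  refine ⟨g + (b - g w) • (h - h v • g), ?_, ?_⟩
  · simp [hg]
  · simp only [add_apply, smul_apply,
      sub_apply, smul_eq_mul]
    linear_combination (b - g w) * hh

/-- Shifting along the orbit applies `R`, so differencing applies `R - 1`. -/
theorem fwdDiff_iter_re_apply_pow (R : X →L[ℂ] X) (f : X →L[ℂ] ℂ) (u : ℂ) (x : X) (m i : ℕ) :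
    (fwdDiff 1)^[m] (fun i : ℕ => (u * f ((R ^ i) x)).re) i =
      (u * f (((R - 1) ^ m) ((R ^ i) x))).re := by
  induction m generalizing i with
  | zero => simp
  | succ m ih =>
    rw [Function.iterate_succ_apply', fwdDiff, ih, ih, ← Complex.sub_re, ← mul_sub, ← map_sub,
      ← map_sub, pow_succ (R - 1), mul_apply_eq_comp, sub_apply,
      one_apply_eq_self, pow_succ' R, mul_apply_eq_comp]

theorem abs_fwdDiff_iter_re_apply_pow_le (R : X →L[ℂ] X) (f : X →L[ℂ] ℂ) {u : ℂ} (hu : ‖u‖ = 1)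
    {x : X} {K D : ℝ} (hK : ‖R‖ ≤ K) (hK1 : 1 ≤ K) (m : ℕ) {k l i : ℕ}
    (hx : ‖(R ^ k) x‖ ≤ D) (hki : k ≤ i) (hil : i ≤ k + l) :
    |(fwdDiff 1)^[m] (fun i : ℕ => (u * f ((R ^ i) x)).re) i| ≤
      ‖f‖ * (‖(R - 1) ^ m‖ * (K ^ l * D)) := by
  rw [fwdDiff_iter_re_apply_pow]
  refine (Complex.abs_re_le_norm _).trans ?_
  rw [norm_mul, hu, one_mul]
  refine (f.le_opNorm _).trans (mul_le_mul_of_nonneg_left ?_ (norm_nonneg f))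
  refine (ContinuousLinearMap.le_opNorm _ _).trans
    (mul_le_mul_of_nonneg_left ?_ (norm_nonneg _))
  obtain ⟨j, rfl⟩ := Nat.exists_eq_add_of_le hki
  have hpow : ‖(R ^ j) ((R ^ k) x)‖ ≤ K ^ j * ‖(R ^ k) x‖ := by
    clear hki hil
    induction j with
    | zero => simp
    | succ j ih =>
      rw [pow_succ', mul_apply_eq_comp, pow_succ', mul_assoc]
      exact (R.le_opNorm _).trans (mul_le_mul hK ih (norm_nonneg _) (by linarith))
  rw [add_comm k j, pow_add, mul_apply_eq_comp]
  refine hpow.trans (mul_le_mul ?_ hx (norm_nonneg _) (by positivity))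
  exact pow_le_pow_right₀ hK1 (by omega)

end

/-! ### Return times against quasinilpotence. -/

theorem sign_changes_orbit_bound {X : Type*} [NormedAddCommGroup X] [NormedSpace ℂ X]
    (R : X →L[ℂ] X) (f : X →L[ℂ] ℂ) {u : ℂ} (hu : ‖u‖ = 1) {x : X} {K D c : ℝ} (hc : 0 < c)
    (hK : ‖R‖ ≤ K) (hK1 : 1 ≤ K) {A : Finset ℕ} (hA : A.Nonempty) {k n : ℕ}
    (hAk : A ⊆ Finset.Icc k (k + n)) (hD : ∀ i ∈ A, ‖(R ^ i) x‖ ≤ D)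
    (h1 : ∀ i ∈ A, c ≤ (u * f ((R ^ i) x)).re)
    (h2 : ∀ i ∈ A, (u * f ((R ^ (i + 1)) x)).re ≤ -c) :
    c ≤ ‖f‖ * D * ‖(R - 1) ^ (2 * A.card - 1)‖ * (K * Real.exp 1) ^ (n + 1) := by
  have hmin := A.min'_mem hA
  -- The window is restarted at the first point of `A`, because the orbit is known to have norm at
  -- most `D` only at points of `A`.
  have hsub : A ⊆ Finset.Icc (A.min' hA) (A.min' hA + n) := fun i hi => by
    have e1 := Finset.mem_Icc.1 (hAk hi)
    have e2 := Finset.mem_Icc.1 (hAk hmin)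
    exact Finset.mem_Icc.2 ⟨A.min'_le i hi, by omega⟩
  have h := sign_changes_bound (fun i : ℕ => (u * f ((R ^ i) x)).re) c _ hc A hA _ n hsub h1 h2
    fun i hi hi' => abs_fwdDiff_iter_re_apply_pow_le R f hu hK hK1 _ (hD _ hmin) hi hi'
  refine h.trans (le_of_eq ?_)
  rw [mul_pow, ← Real.exp_nat_mul]
  push_cast
  ring_nf

/-- If the orbits of `R` under `f` jump from near `z ^ (-n)` to near `-z ^ (-n)` along sets of
positive upper Banach density, then `R - 1` is not quasinilpotent. -/
theorem not_isQuasinilpotentOp_of_returnTimes {X : Type*} [NormedAddCommGroup X]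
    [NormedSpace ℂ X] [CompleteSpace X] (R : X →L[ℂ] X) (f : X →L[ℂ] ℂ) {z : ℂ} (hz : ‖z‖ = 1)
    {x : X} {D : ℝ} {A : Set ℕ} (hA : 0 < upperBanachDensity A)
    (hD : ∀ i ∈ A, ‖(R ^ i) x‖ ≤ D)
    (h1 : ∀ i ∈ A, ‖z ^ i * f ((R ^ i) x) - 1‖ < 1 / 4)
    (h2 : ∀ i ∈ A, ‖-(z ^ i * f ((R ^ (i + 1)) x)) - 1‖ < 1 / 4) :
    ¬ IsQuasinilpotentOp (R - 1) := by
  intro hS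
  obtain ⟨d, hd, hwin⟩ := exists_window_of_upperBanachDensity_pos hA
  set K := max 1 ‖R‖
  have hK1 : 1 ≤ K := le_max_left _ _
  set M := K * Real.exp 1 with hM
  have hM1 : 1 ≤ M := by
    nlinarith [Real.one_le_exp zero_le_one]
  -- With `m ≥ d n / 4`, this gives `q m ≥ 2n ≥ n + 1`, so the growth `M ^ (n + 1)` is at most `(M ^
  -- q) ^ m`. The rate `η = (2 M ^ q)⁻¹` beats it and leaves `(1/2) ^ m`.
  obtain ⟨q, hq⟩ := exists_nat_ge (8 / d)
  have hMq : 0 < M ^ q := by positivity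
  have hη : 0 < (2 * M ^ q)⁻¹ := by positivity
  have hgeom : Tendsto (fun m : ℕ => ‖f‖ * D * (1 / 2 : ℝ) ^ m) atTop (𝓝 (‖f‖ * D * 0)) :=
    (tendsto_pow_atTop_nhds_zero_of_lt_one (by norm_num) (by norm_num)).const_mul _
  rw [mul_zero] at hgeom
  obtain ⟨m₀, hm₀⟩ := eventually_atTop.1 ((hS.eventually_norm_pow_le hη).and
    (hgeom.eventually_lt_const (by norm_num : (0 : ℝ) < 1 / 4)))
  obtain ⟨n₀, hn₀⟩ := exists_nat_ge (4 * m₀ / d)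
  obtain ⟨n, ⟨⟨k, hk⟩, hn⟩, hn1⟩ :=
    ((hwin.and (eventually_ge_atTop n₀)).and (eventually_ge_atTop 1)).exists
  have hn' : (1 : ℝ) ≤ n := by exact_mod_cast hn1
  classical
  set W := (Finset.Icc k (k + n)).filter (· ∈ A) with hW
  have hWcard : (A ∩ Set.Icc k (k + n)).ncard = W.card := by
    rw [← Set.ncard_coe_finset]
    congr 1
    ext i
    simp [hW, and_comm]
  rw [hWcard] at hk
  have hz0 : z ≠ 0 := by rintro rfl; simp at hz
  -- The value `f (R ^ i x)` is near `z ^ (-i)`, whose argument varies with `i`. Pigeonhole on the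
  -- four rotations fixes one `u` for a quarter of the return times.
  choose g hgmem hg using fun i : ℕ => exists_half_le_re_mul ((z ^ i)⁻¹) (by simp [hz])
  have hfour : ({1, -1, Complex.I, -Complex.I} : Finset ℂ).card ≤ 4 := Finset.card_le_four
  obtain ⟨u, hu, hcard⟩ := Finset.exists_le_card_fiber_of_nsmul_le_card_of_maps_to
    (s := W) (t := {1, -1, Complex.I, -Complex.I}) (f := g) (b := d * n / 4)
    (fun i _ => hgmem i) ⟨1, by simp⟩ (by
      rw [nsmul_eq_mul]
      have : ((({1, -1, Complex.I, -Complex.I} : Finset ℂ).card : ℕ) : ℝ) ≤ 4 := by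
        exact_mod_cast hfour
      calc _ ≤ 4 * (d * n / 4) := mul_le_mul_of_nonneg_right this (by positivity)
        _ = d * n := by ring
        _ ≤ _ := hk.le)
  set B := W.filter (fun i => g i = u)
  have hu1 := norm_eq_one_of_mem_fourth_roots hu
  have hB0 : (0 : ℝ) < B.card := lt_of_lt_of_le (by positivity) hcard
  have hBpos : 0 < B.card := by exact_mod_cast hB0
  have hBW : ∀ i ∈ B, i ∈ A := fun i hi => (Finset.mem_filter.1 (Finset.mem_filter.1 hi).1).2
  have hre : ∀ i ∈ B, 1 / 2 ≤ (u * (z ^ i)⁻¹).re := fun i hi => by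
    have := hg i
    rwa [(Finset.mem_filter.1 hi).2] at this
  have hnorm : ∀ i : ℕ, ‖u * (z ^ i)⁻¹‖ = 1 := fun i => by simp [hu1, hz]
  have hcancel : ∀ (i : ℕ) (y : ℂ), u * (z ^ i)⁻¹ * (z ^ i * y) = u * y := fun i y => by
    rw [mul_assoc, inv_mul_cancel_left₀ (pow_ne_zero i hz0)]
  have hmain := sign_changes_orbit_bound R f hu1 (by norm_num : (0 : ℝ) < 1 / 4)
    (le_max_right 1 ‖R‖) hK1 (Finset.card_pos.1 hBpos)
    (fun i hi => (Finset.mem_filter.1 (Finset.mem_filter.1 hi).1).1)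
    (fun i hi => hD i (hBW i hi))
    (fun i hi => by
      have := quarter_le_re_mul (hnorm i) (hre i hi) (h1 i (hBW i hi))
      rwa [hcancel] at this)
    (fun i hi => by
      have := quarter_le_re_mul (hnorm i) (hre i hi) (h2 i (hBW i hi))
      rw [mul_neg, hcancel, Complex.neg_re] at this
      linarith)
  set m := 2 * B.card - 1 with hm
  have hBm : B.card ≤ m := by omega
  have hdm : d * n / 4 ≤ m := hcard.trans (by exact_mod_cast hBm)
  have hm0 : m₀ ≤ m := by
    have e1 : 4 * m₀ / d ≤ n := hn₀.trans (by exact_mod_cast hn)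
    rw [div_le_iff₀ hd] at e1
    have : (m₀ : ℝ) ≤ m := by linarith
    exact_mod_cast this
  have hnq : n + 1 ≤ q * m := by
    have e1 : 8 ≤ q * d := (div_le_iff₀ hd).1 hq
    have e2 : 2 * (n : ℝ) ≤ q * (d * n / 4) := by nlinarith
    have e3 : (q : ℝ) * (d * n / 4) ≤ q * m := mul_le_mul_of_nonneg_left hdm (by positivity)
    have : (n : ℝ) + 1 ≤ q * m := by linarith
    exact_mod_cast this
  obtain ⟨hpow, hsmall⟩ := hm₀ m hm0
  obtain ⟨i, hi⟩ := Finset.card_pos.1 hBpos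
  have hD0 : 0 ≤ D := (norm_nonneg _).trans (hD i (hBW i hi))
  have hlast : ‖f‖ * D * ‖(R - 1) ^ m‖ * M ^ (n + 1) ≤ ‖f‖ * D * (1 / 2 : ℝ) ^ m := by
    rw [mul_assoc]
    refine mul_le_mul_of_nonneg_left ?_ (by positivity)
    calc ‖(R - 1) ^ m‖ * M ^ (n + 1) ≤ (2 * M ^ q)⁻¹ ^ m * M ^ (q * m) :=
          mul_le_mul hpow (pow_le_pow_right₀ hM1 hnq) (by positivity) (by positivity)
      _ = (1 / 2 : ℝ) ^ m := by
          rw [pow_mul, ← mul_pow]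
          congr 1
          field_simp
  linarith

theorem mainTheorem5 {X : Type*} [NormedAddCommGroup X] [NormedSpace ℂ X] [CompleteSpace X]
    (T : X →L[ℂ] X) (hT : HasPProperty positiveUpperBanachDensity T)
    (z : ℂ) (hz : ‖z‖ = 1) :
    T = z • ContinuousLinearMap.id ℂ X ∨
      ¬ IsQuasinilpotentOp (T - z • ContinuousLinearMap.id ℂ X) := by
  rw [or_iff_not_imp_right, not_not]
  intro hQ
  by_contra hne
  have hz0 : z ≠ 0 := by rintro rfl; simp at hz
  set Q := T - z • ContinuousLinearMap.id ℂ X with hQdef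
  have hQx : ∀ x, Q x = T x - z • x := fun x => by simp [hQdef]
  obtain ⟨v, hv⟩ : ∃ v, Q v ≠ 0 := by
    by_contra! h
    exact hne (sub_eq_zero.1 (ContinuousLinearMap.ext h))
  have hv0 : v ≠ 0 := by rintro rfl; simp at hv
  -- The value `-2 z` at `Q v = T v - z • v` is what makes `f (T v) = -z`.
  obtain ⟨f, hf1, hf2⟩ := exists_dual_apply_eq hv0
    (fun c hc => hv (hc.trans (hQ.eq_zero_of_apply_eq_smul hc))) (-2 * z)
  have hfT : f (T v) = -z := by
    rw [show T v = Q v + z • v by rw [hQx]; abel, map_add, hf2, map_smul, hf1, smul_eq_mul]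
    ring
  have hU : IsOpen {y | ‖y‖ < ‖v‖ + 1 ∧ ‖f y - 1‖ < 1 / 4 ∧ ‖-(z⁻¹ * f (T y)) - 1‖ < 1 / 4} := by
    simp only [Set.ofPred_and]
    exact (isOpen_lt (by fun_prop) (by fun_prop)).inter
      ((isOpen_lt (by fun_prop) (by fun_prop)).inter (isOpen_lt (by fun_prop) (by fun_prop)))
  obtain ⟨x, hx⟩ := hT _ hU
    ⟨v, by simp, by simp [hf1], by simp [hfT, hz0]⟩
  have hRpow : ∀ (i : ℕ) (y : X), ((z⁻¹ • T) ^ i) y = (z ^ i)⁻¹ • (T ^ i) y := fun i y => by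
    rw [smul_pow, inv_pow]; rfl
  refine not_isQuasinilpotentOp_of_returnTimes (z⁻¹ • T) f hz (x := x) hx (D := ‖v‖ + 1)
    (fun i hi => ?_) (fun i hi => ?_) (fun i hi => ?_) ?_
  · rw [hRpow, norm_smul, norm_inv, norm_pow, hz, one_pow, inv_one, one_mul]
    exact hi.1.le
  · rw [hRpow, map_smul, smul_eq_mul, mul_inv_cancel_left₀ (pow_ne_zero i hz0)]
    exact hi.2.1
  · have h : z ^ i * f (((z⁻¹ • T) ^ (i + 1)) x) = z⁻¹ * f (T ((T ^ i) x)) := by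
      rw [hRpow, map_smul, smul_eq_mul, pow_succ' T, mul_apply_eq_comp, pow_succ]
      field_simp
    rw [h]
    exact hi.2.2
  -- Scaling by a unimodular number preserves the norms of powers, hence the spectral radius.
  · have hR : z⁻¹ • T - 1 = z⁻¹ • Q := by
      rw [hQdef, smul_sub, smul_smul, inv_mul_cancel₀ hz0, one_smul]; rfl
    have hpow : ∀ m : ℕ, ‖(z⁻¹ • T - 1) ^ m‖ = ‖Q ^ m‖ := fun m => by
      rw [hR, smul_pow, norm_smul, norm_pow, norm_inv, hz, inv_one, one_pow, one_mul]
    have h1 := spectrum.pow_norm_pow_one_div_tendsto_nhds_spectralRadius (z⁻¹ • T - 1)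
    simp only [hpow] at h1
    exact (tendsto_nhds_unique h1
      (spectrum.pow_norm_pow_one_div_tendsto_nhds_spectralRadius Q)).trans hQ
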